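/- **Theorem 1.1.** For every $C\ge 1$ there are a homeomorphism $\eta:[0,\infty)\to[0,\infty)$ and a number $\delta\in(0,1]$, depending only on $C$, such that the following holds. Let $n\ge 1$ and let $\mu$ be a nonzero positive Radon measure on $\mathbb{R}^n$ that is doubling with constant $C$, i.e. $\mu(2B)\le C\mu(B)$ for every closed ball $B$ (where $2B$ is the concentric ball of twice the radius), and suppose that $$\int_{|z|>1}|z|^{-1}\,d\mu(z)<\infty .$$ Then for every $x\in\mathbb{R}^n$ the integral $$f_\mu(x)=\frac12\int_{\mathbb{R}^n}\left\{\frac{x-z}{|x-z|}+\frac{z}{|z|}\right\}d\mu(z)$$ converges absolutely, and the map $f_\mu:\mathbb{R}^n\to\mathbb{R}^n$ has the following properties. 1. $f_\mu$ is $\eta$-quasisymmetric: it is injective, and $$\frac{|f_\mu(x)-f_\mu(z)|}{|f_\mu(y)-f_\mu(z)|}\le\eta\left(\frac{|x-z|}{|y-z|}\right)\qquad\text{for all } z\in\mathbb{R}^n,\ x,y\in\mathbb{R}^n\setminus\{z\}.$$ 2. $f_\mu$ is $\delta$-monotone: $\langle f_\mu(x)-f_\mu(y),x-y\rangle\ge\delta\,|f_\mu(x)-f_\mu(y)|\,|x-y|$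 for all $x,y\in\mathbb{R}^n$. 3. If $n\ge2$, then for Lebesgue-almost every $x\in\mathbb{R}^n$ the map $f_\mu$ is differentiable at $x$ and the operator norm of its derivative satisfies $$\frac{1}{12C^3}\,\mathcal{I}_{n-1}\mu(x)\le\|Df_\mu(x)\|\le\pi\,\mathcal{I}_{n-1}\mu(x),\qquad \mathcal{I}_{n-1}\mu(x)=\int_{\mathbb{R}^n}|x-z|^{-1}\,d\mu(z).$$ -/

import Mathlib

open MeasureTheory Metric Set
open scoped NNReal ENNReal

noncomputable section

/-- `μ (2B) ≤ C μ (B)` for every closed ball `B` of positive radius. -/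
def HasDoublingConstant {E : Type*} [PseudoMetricSpace E] [MeasurableSpace E]
    (μ : Measure E) (C : ℝ) : Prop :=
  ∀ (x : E) (r : ℝ), 0 < r →
    μ (closedBall x (2 * r)) ≤ ENNReal.ofReal C * μ (closedBall x r)

/-- The decay condition: the integral of `|z|⁻¹` over `|z| > 1` is finite. -/
def HasDecay {E : Type*} [NormedAddCommGroup E] [MeasurableSpace E] (μ : Measure E) : Prop :=
  ∫⁻ z in {z : E | 1 < ‖z‖}, ‖z‖ₑ⁻¹ ∂μ < ∞

/-- The integrand `(x - z) / |x - z| + z / |z|`. -/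
def kernelMap {n : ℕ} (x z : EuclideanSpace ℝ (Fin n)) : EuclideanSpace ℝ (Fin n) :=
  ‖x - z‖⁻¹ • (x - z) + ‖z‖⁻¹ • z

/-- The map `f_μ`, half the integral of the kernel. -/
def fMap {n : ℕ} (μ : Measure (EuclideanSpace ℝ (Fin n))) (x : EuclideanSpace ℝ (Fin n)) :
    EuclideanSpace ℝ (Fin n) :=
  (1 / 2 : ℝ) • ∫ z, kernelMap x z ∂μ

/-- The Riesz potential of order `γ`, with values in `[0, ∞]`
(the kernel is `∞` on the diagonal when `γ < n`). -/
def rieszPotential {n : ℕ} (γ : ℝ) (μ : Measure (EuclideanSpace ℝ (Fin n)))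
    (x : EuclideanSpace ℝ (Fin n)) : ℝ≥0∞ :=
  ∫⁻ z, ‖x - z‖ₑ ^ (γ - (n : ℝ)) ∂μ

/-- `δ`-monotone maps, `0 < δ ≤ 1`. -/
def IsDeltaMonotone {E : Type*} [NormedAddCommGroup E] [InnerProductSpace ℝ E]
    (δ : ℝ) (f : E → E) : Prop :=
  0 < δ ∧ δ ≤ 1 ∧ ∀ x y : E, δ * ‖f x - f y‖ * ‖x - y‖ ≤ inner ℝ (f x - f y) (x - y)

/-- `η`-quasisymmetric maps, `η` being a homeomorphism of `[0, ∞)` onto itself. -/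
def IsQuasisymmetric {E : Type*} [NormedAddCommGroup E]
    (η : ℝ≥0 ≃ₜ ℝ≥0) (f : E → E) : Prop :=
  Function.Injective f ∧ ∀ x y z : E, x ≠ z → y ≠ z →
    ‖f x - f z‖₊ / ‖f y - f z‖₊ ≤ η (‖x - z‖₊ / ‖y - z‖₊)

end

/-!
Write `u v = v / |v|`, so that `f_μ x - f_μ y = ½ ∫ (u (x - w) - u (y - w)) dμ(w)`.

Everything in the first two assertions follows from one two-sided estimate. In dimension at least
two put `Φ y r = ∫ r / (r + |y - w|) dμ(w)`, which is finite by the decay condition. The bound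
`|u a - u b| ≤ 4 r / (r + |b|)`, `r = |a - b|`, gives `|f_μ x - f_μ y| ≤ 2 Φ y |x - y|`. Conversely
`⟨u a - u b, a - b⟩` is nonnegative, and it is at least `r² / (4 (r + |b|))` when `a - b` makes an
angle of at least `45°` with the line spanned by `b` (`sq_norm_sub_le_inner_unitDir`). By doubling,
each dyadic annulus about `y` has mass comparable to that of a ball inside it centred on the
hyperplane through `y` orthogonal to `x - y`, where this holds; summing over the annuli gives
`|x - y| Φ y |x - y| ≤ 32 C⁴ ⟨f_μ x - f_μ y, x - y⟩`
(`HasDoublingConstant.mul_integral_le_integral_inner`). On the line there is no orthogonal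
direction, but `u (x - w) - u (y - w)` vanishes unless `w` lies between `x` and `y`, and the same
estimates hold with `Φ y r = μ (B (y, r))`.

The two bounds yield `δ`-monotonicity at once. For quasisymmetry, `Φ y` is increasing, at most
multiplies by `2 C` when the radius is doubled, and shrinks by a factor depending on `C` when it is
halved, because the outer half of a ball carries a fixed part of its mass. Hence `Φ y s / Φ y r` is
at most a constant times `(s / r) ^ α + (s / r) ^ β` (`exists_power_growth`), and this is `η`.

In dimension at least two the potential `∫ |x - z|⁻¹ dμ(z)` is finite for almost every `x`, by
Tonelli. At such points the kernel may be differentiated under the integral sign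
(`HasDecay.hasFDerivAt_fMap`). The upper bound for the derivative is the one for `u`, and the lower
bound comes from the trace, which is `(n - 1) / 2` times the potential
(`HasDecay.fderiv_fMap_bounds`).
-/

/-! ### The direction field `v ↦ v / |v|` -/

section Direction

variable {E : Type*} [NormedAddCommGroup E] [InnerProductSpace ℝ E]

/-- The direction `v / |v|` of a vector, with value `0` at `v = 0`. -/
noncomputable def unitDir (v : E) : E := ‖v‖⁻¹ • v

lemma norm_unitDir_le_one (v : E) : ‖unitDir v‖ ≤ 1 := by
  rw [unitDir, norm_smul, norm_inv, norm_norm]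
  exact inv_mul_le_one

lemma norm_smul_unitDir (v : E) : ‖v‖ • unitDir v = v := by
  rcases eq_or_ne v 0 with rfl | hv
  · simp
  · rw [unitDir, smul_smul, mul_inv_cancel₀ (norm_ne_zero_iff.2 hv), one_smul]

lemma inner_unitDir_self (v : E) : inner ℝ (unitDir v) v = ‖v‖ := by
  rcases eq_or_ne v 0 with rfl | hv
  · simp
  · have := norm_ne_zero_iff.2 hv
    rw [unitDir, real_inner_smul_left, real_inner_self_eq_norm_sq]
    field_simp

lemma norm_unitDir_sub_le_two (a b : E) : ‖unitDir a - unitDir b‖ ≤ 2 := by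
  linarith [norm_sub_le (unitDir a) (unitDir b), norm_unitDir_le_one a, norm_unitDir_le_one b]

lemma norm_unitDir_sub_mul_norm_le (a b : E) :
    ‖unitDir a - unitDir b‖ * ‖b‖ ≤ 2 * ‖a - b‖ := by
  have key : ‖b‖ • (unitDir a - unitDir b) = (‖b‖ - ‖a‖) • unitDir a + (a - b) := by
    rw [smul_sub, sub_smul, norm_smul_unitDir, norm_smul_unitDir]
    abel
  calc ‖unitDir a - unitDir b‖ * ‖b‖ = ‖‖b‖ • (unitDir a - unitDir b)‖ := by
        rw [norm_smul, norm_norm, mul_comm]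
    _ ≤ ‖(‖b‖ - ‖a‖) • unitDir a‖ + ‖a - b‖ := key ▸ norm_add_le _ _
    _ ≤ ‖a - b‖ + ‖a - b‖ := by
        gcongr
        rw [norm_smul, Real.norm_eq_abs, abs_sub_comm]
        calc |‖a‖ - ‖b‖| * ‖unitDir a‖ ≤ ‖a - b‖ * 1 := by
              gcongr
              · exact abs_norm_sub_norm_le a b
              · exact norm_unitDir_le_one a
          _ = ‖a - b‖ := mul_one _
    _ = 2 * ‖a - b‖ := by ring

lemma norm_unitDir_sub_le_div {a b : E} (h : 0 < ‖a - b‖) :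
    ‖unitDir a - unitDir b‖ ≤ 4 * (‖a - b‖ / (‖a - b‖ + ‖b‖)) := by
  have h1 := norm_unitDir_sub_mul_norm_le a b
  have h2 := mul_le_mul_of_nonneg_right (norm_unitDir_sub_le_two a b) h.le
  rw [← mul_div_assoc, le_div_iff₀ (by positivity)]
  linarith

lemma inner_unitDir_sub (a b : E) :
    inner ℝ (unitDir a - unitDir b) (a - b)
      = ‖a‖ + ‖b‖ - inner ℝ (unitDir a) b - inner ℝ (unitDir b) a := by
  simp only [inner_sub_left, inner_sub_right, inner_unitDir_self]
  ring

lemma inner_unitDir_sub_nonneg (a b : E) : 0 ≤ inner ℝ (unitDir a - unitDir b) (a - b) := by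
  have h (v w : E) : inner ℝ (unitDir v) w ≤ ‖w‖ :=
    (real_inner_le_norm _ _).trans
      (mul_le_of_le_one_left (norm_nonneg _) (norm_unitDir_le_one v))
  rw [inner_unitDir_sub]
  linarith [h a b, h b a]

/-- Quantitative monotonicity of the direction field at increments `a - b` that make an angle of
at least `45°` with the line spanned by `b`. -/
lemma sq_norm_sub_le_inner_unitDir {a b : E} (hb : b ≠ 0)
    (hab : 2 * inner ℝ b (a - b) ^ 2 ≤ ‖b‖ ^ 2 * ‖a - b‖ ^ 2) :
    ‖a - b‖ ^ 2 ≤ 4 * (‖a - b‖ + ‖b‖) * inner ℝ (unitDir a - unitDir b) (a - b) := by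
  have hB : 0 < ‖b‖ := norm_pos_iff.2 hb
  have ha : a ≠ 0 := by
    rintro rfl
    rw [zero_sub, norm_neg, inner_neg_right, real_inner_self_eq_norm_sq] at hab
    nlinarith [pow_pos hB 4]
  have hA : 0 < ‖a‖ := norm_pos_iff.2 ha
  have hA' : ‖a‖ ≤ ‖a - b‖ + ‖b‖ := by simpa using norm_add_le (a - b) b
  have hr := norm_sub_sq_real a b
  have hs := real_inner_le_norm a b
  have hI : ‖a‖ * ‖b‖ * inner ℝ (unitDir a - unitDir b) (a - b)
      = (‖a‖ + ‖b‖) * (‖a‖ * ‖b‖ - inner ℝ a b) := by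
    rw [inner_unitDir_sub, unitDir, unitDir, real_inner_smul_left, real_inner_smul_left,
      real_inner_comm a b]
    field_simp
    ring
  have hI0 := inner_unitDir_sub_nonneg a b
  rw [inner_sub_right, real_inner_self_eq_norm_sq, real_inner_comm] at hab
  generalize inner ℝ (unitDir a - unitDir b) (a - b) = I at *
  generalize inner ℝ a b = s at *
  generalize ‖a - b‖ = r at *
  generalize ‖a‖ = A at *
  generalize ‖b‖ = B at *
  -- the Gram determinant `A²B² - s²` of `a` and `b` is at least `B²r²/2`
  have h1 : B ^ 2 * r ^ 2 ≤ 2 * (A * B - s) * (A * B + s) := by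
    have : B ^ 2 * r ^ 2 = B ^ 2 * (A ^ 2 - 2 * s + B ^ 2) := by rw [hr]
    nlinarith
  have h2 : B * (B * r ^ 2) ≤ B * (4 * A * (A * B - s)) := by nlinarith
  have h3 : B * r ^ 2 ≤ 4 * A * (A * B - s) := le_of_mul_le_mul_left h2 hB
  have h4 : (A * B) * r ^ 2 ≤ (A * B) * (4 * A * I) := by
    calc (A * B) * r ^ 2 ≤ (A + B) * (B * r ^ 2) := by nlinarith [mul_nonneg hB.le (sq_nonneg r)]
      _ ≤ (A + B) * (4 * A * (A * B - s)) := by gcongr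
      _ = (A * B) * (4 * A * I) := by linear_combination (-4 * A) * hI
  have h5 : r ^ 2 ≤ 4 * A * I := le_of_mul_le_mul_left h4 (by positivity)
  nlinarith

/-- Quantitative monotonicity of the direction field when the origin is near the midpoint of the
segment from `a` to `b`. -/
lemma norm_sub_le_inner_unitDir {a b : E} (hab : 2 * ‖a + b‖ ≤ ‖a - b‖) :
    2 * ‖a - b‖ ≤ 3 * inner ℝ (unitDir a - unitDir b) (a - b) := by
  have key (c d : E) (hcd : 2 * ‖c + d‖ ≤ ‖c - d‖) :
      ‖c - d‖ ≤ 3 * inner ℝ (unitDir c) (c - d) := by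
    rcases (norm_nonneg (c - d)).eq_or_lt with h0 | h0
    · rw [← h0, norm_eq_zero.1 h0.symm, inner_zero_right, mul_zero]
    have h1 : 2 * inner ℝ c (c - d) = ‖c - d‖ ^ 2 + inner ℝ (c + d) (c - d) := by
      rw [← real_inner_self_eq_norm_sq, ← inner_add_left, ← real_inner_smul_left]
      congr 1
      module
    have h2 : -(‖c + d‖ * ‖c - d‖) ≤ inner ℝ (c + d) (c - d) :=
      (abs_le.1 (abs_real_inner_le_norm _ _)).1
    have h3 : ‖c - d‖ ^ 2 ≤ 4 * inner ℝ c (c - d) := by nlinarith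
    have h4 : 2 * ‖c‖ ≤ ‖c - d‖ + ‖c + d‖ := by
      calc 2 * ‖c‖ = ‖(c - d) + (c + d)‖ := by
            rw [show (c - d) + (c + d) = (2 : ℝ) • c by module, norm_smul]; norm_num
        _ ≤ _ := norm_add_le _ _
    have h5 : ‖c‖ * inner ℝ (unitDir c) (c - d) = inner ℝ c (c - d) := by
      rw [← real_inner_smul_left, norm_smul_unitDir]
    have hc : 0 < ‖c‖ := by
      rw [norm_pos_iff]
      rintro rfl
      simp only [inner_zero_left] at h3
      nlinarith
    refine le_of_mul_le_mul_left ?_ hc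
    nlinarith
  have h1 := key a b hab
  have h2 := key b a (by rwa [add_comm, norm_sub_rev])
  rw [norm_sub_rev, ← neg_sub a b, inner_neg_right] at h2
  rw [inner_sub_left]
  linarith

/-- On a line the direction field is locally constant away from the origin. -/
lemma unitDir_eq_of_finrank_eq_one (hE : Module.finrank ℝ E = 1) {a b : E}
    (h : ‖a - b‖ < ‖b‖) : unitDir a = unitDir b := by
  have hb : b ≠ 0 := norm_pos_iff.1 ((norm_nonneg _).trans_lt h)
  obtain ⟨t, rfl⟩ := (finrank_eq_one_iff_of_nonzero' b hb).1 hE a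
  have h1 : |t - 1| < 1 := by
    rw [show t • b - b = (t - 1) • b by module, norm_smul, Real.norm_eq_abs] at h
    exact lt_of_mul_lt_mul_right (by linarith) (norm_nonneg b)
  have ht : 0 < t := by linarith [(abs_lt.1 h1).1]
  rw [unitDir, unitDir, norm_smul, Real.norm_of_nonneg ht.le, smul_smul]
  congr 1
  field_simp

/-- The derivative `(I - v vᵀ / |v|²) / |v|` of the direction field. -/
noncomputable def unitDirDeriv (v : E) : E →L[ℝ] E :=
  ‖v‖⁻¹ • ContinuousLinearMap.id ℝ E - (‖v‖⁻¹ ^ 3) • (innerSL ℝ v).smulRight v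

lemma hasFDerivAt_unitDir {v : E} (hv : v ≠ 0) : HasFDerivAt unitDir (unitDirDeriv v) v := by
  have hn : ‖v‖ ≠ 0 := norm_ne_zero_iff.2 hv
  have h1 : HasFDerivAt (fun w : E => ‖w‖ ^ 2) (2 • innerSL ℝ v) v :=
    (hasStrictFDerivAt_norm_sq v).hasFDerivAt
  have h2 : HasFDerivAt (fun w : E => ‖w‖) (‖v‖⁻¹ • innerSL ℝ v) v := by
    have := h1.sqrt (pow_ne_zero 2 hn)
    simp only [Real.sqrt_sq (norm_nonneg _)] at this
    convert this using 1
    ext w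
    simp
    field_simp
  have h3 := ((hasDerivAt_inv hn).comp_hasFDerivAt v h2).smul (hasFDerivAt_id v)
  refine h3.congr_fderiv ?_
  ext w
  simp [unitDirDeriv, sub_eq_add_neg, smul_smul]
  field_simp

end Direction

/-! ### Doubling measures -/

section Doubling

variable {E : Type*} [NormedAddCommGroup E] [InnerProductSpace ℝ E] [FiniteDimensional ℝ E]
  [MeasurableSpace E] [BorelSpace E] {μ : Measure E} [IsLocallyFiniteMeasure μ] {C : ℝ}

lemma HasDoublingConstant.measureReal_closedBall_two_mul_le (h : HasDoublingConstant μ C)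
    (hC : 1 ≤ C) (x : E) {r : ℝ} (hr : 0 < r) :
    μ.real (closedBall x (2 * r)) ≤ C * μ.real (closedBall x r) := by
  have := ENNReal.toReal_mono (ENNReal.mul_ne_top ENNReal.ofReal_ne_top
    measure_closedBall_lt_top.ne) (h x r hr)
  rwa [ENNReal.toReal_mul, ENNReal.toReal_ofReal (by linarith)] at this

lemma HasDoublingConstant.measureReal_closedBall_le (h : HasDoublingConstant μ C) (hC : 1 ≤ C)
    {x y : E} {r R : ℝ} (hr : 0 < r) (k : ℕ) (hR : dist y x + R ≤ 2 ^ k * r) :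
    μ.real (closedBall y R) ≤ C ^ k * μ.real (closedBall x r) := by
  have hk (k : ℕ) : μ.real (closedBall x (2 ^ k * r)) ≤ C ^ k * μ.real (closedBall x r) := by
    induction k with
    | zero => simp
    | succ k ih =>
      rw [pow_succ', mul_assoc, pow_succ', mul_assoc]
      exact (h.measureReal_closedBall_two_mul_le hC x (by positivity)).trans (by gcongr)
  refine le_trans (measureReal_mono (closedBall_subset_closedBall' ?_)
    measure_closedBall_lt_top.ne) (hk k)
  linarith

lemma HasDoublingConstant.measureReal_closedBall_pos (h : HasDoublingConstant μ C) (hC : 1 ≤ C)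
    (hμ : μ ≠ 0) (x : E) {r : ℝ} (hr : 0 < r) : 0 < μ.real (closedBall x r) := by
  by_contra hneg
  have h0 : μ.real (closedBall x r) = 0 := le_antisymm (not_lt.1 hneg) measureReal_nonneg
  refine hμ (Measure.measure_univ_eq_zero.1 ?_)
  rw [← iUnion_closedBall_nat x, measure_iUnion_null_iff]
  intro N
  obtain ⟨k, hk⟩ := pow_unbounded_of_one_lt ((N : ℝ) / r) one_lt_two
  have := h.measureReal_closedBall_le hC (x := x) (y := x) (R := N) hr k
    (by rw [dist_self, zero_add]; exact ((div_lt_iff₀ hr).1 hk).le)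
  rw [h0, mul_zero] at this
  exact (measureReal_eq_zero_iff measure_closedBall_lt_top.ne).1
    (le_antisymm this measureReal_nonneg)

/-- The annulus of radii `r / 2` and `r` carries a fixed part of the mass of a ball, since it
contains a ball of comparable size. -/
lemma HasDoublingConstant.measureReal_closedBall_le_annulus [Nontrivial E]
    (h : HasDoublingConstant μ C) (hC : 1 ≤ C) (y : E) {r : ℝ} (hr : 0 < r) :
    μ.real (closedBall y r) ≤ C ^ 4 * μ.real (closedBall y r \ closedBall y (r / 2)) := by
  obtain ⟨e, he⟩ := exists_norm_eq E (c := 3 / 4 * r) (by positivity)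
  have hd : dist y (y + e) = 3 / 4 * r := by rw [dist_self_add_right, he]
  refine (h.measureReal_closedBall_le hC (x := y + e) (r := r / 8) (by positivity) 4
    (by rw [hd]; linarith)).trans ?_
  gcongr
  · exact ((measure_mono sdiff_subset).trans_lt measure_closedBall_lt_top).ne
  · intro w hw
    rw [mem_closedBall] at hw
    simp only [mem_sdiff, mem_closedBall, not_le]
    constructor
    · linarith [dist_triangle w (y + e) y, dist_comm y (y + e)]
    · linarith [dist_triangle y w (y + e), dist_comm y w]

omit [IsLocallyFiniteMeasure μ] in
lemma HasDecay.integrableOn_norm_inv (h : HasDecay μ) :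
    IntegrableOn (fun z : E => ‖z‖⁻¹) {z | 1 < ‖z‖} μ := by
  refine ⟨by fun_prop, ?_⟩
  refine lt_of_eq_of_lt (setLIntegral_congr_fun ?_ fun z hz => ?_) h
  · exact (isOpen_lt continuous_const continuous_norm).measurableSet
  · have : ‖z‖ ≠ 0 := (zero_lt_one.trans hz).ne'
    rw [enorm_inv this, enorm_norm]

lemma HasDecay.integrable_div_add_norm (h : HasDecay μ) (y : E) {r : ℝ} (hr : 0 < r) :
    Integrable (fun w => r / (r + ‖y - w‖)) μ := by
  have hm : Measurable fun w : E => r / (r + ‖y - w‖) := by fun_prop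
  rw [← integrableOn_univ, ← compl_union_self {z : E | 1 < ‖z‖}]
  refine IntegrableOn.union ?_ ?_
  · refine Measure.integrableOn_of_bounded (M := 1) ?_ hm.aestronglyMeasurable
      (Filter.Eventually.of_forall fun w => ?_)
    · refine ((measure_mono (t := closedBall 0 1) fun z hz => ?_).trans_lt
        measure_closedBall_lt_top).ne
      simpa using hz
    · rw [Real.norm_of_nonneg (by positivity)]
      exact div_le_one_of_le₀ (by linarith [norm_nonneg (y - w)]) (by positivity)
  · refine (h.integrableOn_norm_inv.const_mul (r + ‖y‖)).mono' hm.aestronglyMeasurable ?_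
    refine (ae_restrict_mem
      (isOpen_lt continuous_const continuous_norm).measurableSet).mono fun w hw => ?_
    have hw0 : 0 < ‖w‖ := zero_lt_one.trans hw
    have hw1 : ‖w‖ ≤ ‖y‖ + ‖y - w‖ := by
      simpa using norm_sub_le y (y - w)
    rw [Real.norm_of_nonneg (by positivity), ← div_eq_mul_inv, div_le_div_iff₀ (by positivity) hw0]
    nlinarith [mul_nonneg (norm_nonneg y) (norm_nonneg (y - w)),
      mul_nonneg hr.le (norm_nonneg y), mul_self_nonneg r]

end Doubling

/-! ### Scale functions with power growth -/

/-- A function of the radius that at most multiplies by `K` under doubling and shrinks by a factor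
`q < 1` under halving lies between two powers of the radius; the exponents and the constant depend
only on `K` and `q`. -/
lemma exists_power_growth {K q : ℝ} (hK : 2 ≤ K) (hq0 : 0 < q) (hq1 : q < 1) :
    ∃ α β M : ℝ, 0 < α ∧ 0 < β ∧ 0 < M ∧ ∀ φ : ℝ → ℝ, (∀ r, 0 < r → 0 ≤ φ r) →
      (∀ r s, 0 < r → r ≤ s → φ r ≤ φ s) → (∀ r, 0 < r → φ (2 * r) ≤ K * φ r) →
      (∀ r, 0 < r → φ (r / 2) ≤ q * φ r) →
      ∀ s r, 0 < s → 0 < r → φ s ≤ M * ((s / r) ^ α + (s / r) ^ β) * φ r := by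
  have hα : 0 < -Real.logb 2 q := neg_pos.2 (Real.logb_neg one_lt_two hq0 hq1)
  have hβ : 0 < Real.logb 2 K := Real.logb_pos one_lt_two (by linarith)
  refine ⟨-Real.logb 2 q, Real.logb 2 K, K + q⁻¹, hα, hβ, by positivity, ?_⟩
  intro φ hφ0 hmono hdbl hhalf s r hs hr
  have hpow (x : ℝ) (hx : 0 < x) (k : ℕ) : ((2 : ℝ) ^ k) ^ Real.logb 2 x = x ^ k := by
    rw [← Real.rpow_natCast, ← Real.rpow_mul zero_le_two, mul_comm, Real.rpow_mul zero_le_two,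
      Real.rpow_logb zero_lt_two (by norm_num) hx, Real.rpow_natCast]
  have hup (k : ℕ) : φ (2 ^ k * r) ≤ K ^ k * φ r := by
    induction k with
    | zero => simp
    | succ k ih =>
      rw [pow_succ', mul_assoc, pow_succ', mul_assoc]
      exact (hdbl _ (by positivity)).trans (by gcongr)
  have hdown (k : ℕ) : φ (r / 2 ^ k) ≤ q ^ k * φ r := by
    induction k with
    | zero => simp
    | succ k ih =>
      rw [pow_succ, ← div_div, pow_succ', mul_assoc]
      exact (hhalf _ (by positivity)).trans (by gcongr)
  have ht : 0 < s / r := by positivity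
  have hφr := hφ0 r hr
  rcases le_total 1 (s / r) with h1 | h1
  · obtain ⟨k, hk1, hk2⟩ := exists_nat_pow_near h1 one_lt_two
    have h2 : φ s ≤ K ^ (k + 1) * φ r :=
      (hmono s _ hs ((div_lt_iff₀ hr).1 hk2).le).trans (hup (k + 1))
    have h3 : K ^ k ≤ (s / r) ^ Real.logb 2 K := by
      rw [← hpow K (by linarith)]
      exact Real.rpow_le_rpow (by positivity) hk1 hβ.le
    refine h2.trans (mul_le_mul_of_nonneg_right ?_ hφr)
    calc K ^ (k + 1) = K * K ^ k := pow_succ' _ _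
      _ ≤ (K + q⁻¹) * ((s / r) ^ (-Real.logb 2 q) + (s / r) ^ Real.logb 2 K) := by
        gcongr
        · exact le_add_of_nonneg_right (by positivity)
        · exact h3.trans (le_add_of_nonneg_left (by positivity))
  · obtain ⟨k, hk1, hk2⟩ := exists_nat_pow_near ((one_le_inv₀ ht).2 h1) one_lt_two
    have h2 : φ s ≤ q ^ k * φ r := by
      refine (hmono s _ hs ?_).trans (hdown k)
      rw [le_div_iff₀ (by positivity), ← le_div_iff₀' hs]
      simpa using hk1
    have h3 : q ^ (k + 1) ≤ (s / r) ^ (-Real.logb 2 q) := by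
      rw [← hpow q hq0, Real.rpow_neg_eq_inv_rpow]
      exact Real.rpow_le_rpow_of_nonpos (by positivity) hk2.le (by linarith)
    refine h2.trans (mul_le_mul_of_nonneg_right ?_ hφr)
    calc q ^ k = q⁻¹ * q ^ (k + 1) := by rw [pow_succ']; field_simp
      _ ≤ (K + q⁻¹) * ((s / r) ^ (-Real.logb 2 q) + (s / r) ^ Real.logb 2 K) := by
        gcongr
        · exact le_add_of_nonneg_left (by positivity)
        · exact h3.trans (le_add_of_nonneg_right (by positivity))

/-- The homeomorphism `t ↦ M (t ^ α + t ^ β)` of `[0, ∞)`. -/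
lemma exists_homeomorph_power_sum {α β M : ℝ} (hα : 0 < α) (hβ : 0 < β) (hM : 0 < M) :
    ∃ η : ℝ≥0 ≃ₜ ℝ≥0, ∀ t : ℝ≥0, (η t : ℝ) = M * ((t : ℝ) ^ α + (t : ℝ) ^ β) := by
  let g : ℝ≥0 → ℝ≥0 := fun t => M.toNNReal * (t ^ α + t ^ β)
  have hM' : 0 < M.toNNReal := Real.toNNReal_pos.2 hM
  have hmono : StrictMono g := fun s t hst => by
    have h1 := NNReal.rpow_lt_rpow hst hα
    have h2 := NNReal.rpow_lt_rpow hst hβ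
    exact mul_lt_mul_of_pos_left (add_lt_add h1 h2) hM'
  have hcont : Continuous g :=
    continuous_const.mul ((NNReal.continuous_rpow_const hα.le).add
      (NNReal.continuous_rpow_const hβ.le))
  have hg0 : g 0 = 0 := by simp [g, hα.ne', hβ.ne']
  have hsurj : Function.Surjective g := by
    intro c
    have htop : Filter.Tendsto g Filter.atTop Filter.atTop := by
      refine Filter.tendsto_atTop_mono (fun t => ?_)
        ((NNReal.tendsto_rpow_atTop hα).const_mul_atTop hM')
      exact mul_le_mul_of_nonneg_left (le_add_of_nonneg_right zero_le) hM'.le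
    obtain ⟨t, ht⟩ := (htop.eventually_ge_atTop c).exists
    obtain ⟨x, -, hx⟩ := intermediate_value_Icc (zero_le (a := t)) hcont.continuousOn
      ⟨hg0.le.trans zero_le, ht⟩
    exact ⟨x, hx⟩
  refine ⟨(hmono.orderIsoOfSurjective g hsurj).toHomeomorph, fun t => ?_⟩
  change ((g t : ℝ≥0) : ℝ) = _
  simp [g, hM.le]

/-! ### Maps controlled by a scale function -/

/-- `Φ` measures the size of the increments of the map `f`: up to constants depending on `C` only,
`|f x - f y|` is `Φ y |x - y|`, and so is the component of `f x - f y` in the direction of `x - y`.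
The function `Φ y` of the radius has power growth. -/
structure IsScaleFunction {E : Type*} [NormedAddCommGroup E] [InnerProductSpace ℝ E]
    (C : ℝ) (f : E → E) (Φ : E → ℝ → ℝ) : Prop where
  pos : ∀ y r, 0 < r → 0 < Φ y r
  mono : ∀ y r s, 0 < r → r ≤ s → Φ y r ≤ Φ y s
  two_mul_le : ∀ y r, 0 < r → Φ y (2 * r) ≤ 2 * C * Φ y r
  half_le : ∀ y r, 0 < r → Φ y (r / 2) ≤ (1 - 1 / (4 * (1 + 2 * C ^ 4))) * Φ y r
  norm_sub_le : ∀ x y, x ≠ y → ‖f x - f y‖ ≤ 2 * Φ y ‖x - y‖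
  le_inner : ∀ x y, x ≠ y →
    ‖x - y‖ * Φ y ‖x - y‖ ≤ 32 * C ^ 4 * inner ℝ (f x - f y) (x - y)

section Scale

variable {E : Type*} [NormedAddCommGroup E] [InnerProductSpace ℝ E] {C : ℝ} {f : E → E}
  {Φ : E → ℝ → ℝ}

lemma IsScaleFunction.le_norm_sub (h : IsScaleFunction C f Φ) (hC : 1 ≤ C) {x y : E}
    (hxy : x ≠ y) : Φ y ‖x - y‖ ≤ 32 * C ^ 4 * ‖f x - f y‖ := by
  have hr : 0 < ‖x - y‖ := norm_pos_iff.2 (sub_ne_zero.2 hxy)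
  refine le_of_mul_le_mul_left ((h.le_inner x y hxy).trans ?_) hr
  calc 32 * C ^ 4 * inner ℝ (f x - f y) (x - y)
      ≤ 32 * C ^ 4 * (‖f x - f y‖ * ‖x - y‖) := by gcongr; exact real_inner_le_norm _ _
    _ = _ := by ring

lemma IsScaleFunction.isDeltaMonotone (h : IsScaleFunction C f Φ) (hC : 1 ≤ C) :
    IsDeltaMonotone (1 / (64 * C ^ 4)) f := by
  have hC4 : 1 ≤ C ^ 4 := one_le_pow₀ hC
  refine ⟨by positivity, div_le_one_of_le₀ (by linarith) (by positivity), fun x y => ?_⟩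
  rcases eq_or_ne x y with rfl | hxy
  · simp
  have h1 := mul_le_mul_of_nonneg_right (h.norm_sub_le x y hxy) (norm_nonneg (x - y))
  have h2 := h.le_inner x y hxy
  rw [mul_assoc, div_mul_eq_mul_div, one_mul, div_le_iff₀ (by positivity)]
  linarith

lemma IsScaleFunction.isQuasisymmetric (h : IsScaleFunction C f Φ) (hC : 1 ≤ C) {α β M : ℝ}
    (hΦ : ∀ y s r, 0 < s → 0 < r → Φ y s ≤ M * ((s / r) ^ α + (s / r) ^ β) * Φ y r)
    {η : ℝ≥0 ≃ₜ ℝ≥0}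
    (hη : ∀ t : ℝ≥0, (η t : ℝ) = 64 * C ^ 4 * M * ((t : ℝ) ^ α + (t : ℝ) ^ β)) :
    IsQuasisymmetric η f := by
  have hpos {x y : E} (hxy : x ≠ y) : 0 < ‖f x - f y‖ := by
    have h1 := h.pos y ‖x - y‖ (norm_pos_iff.2 (sub_ne_zero.2 hxy))
    exact pos_of_mul_pos_right (h1.trans_le (h.le_norm_sub hC hxy)) (by positivity)
  constructor
  · intro x y hxy
    by_contra hne
    have := hpos hne
    rw [hxy, sub_self, norm_zero] at this
    exact lt_irrefl _ this
  · intro x y z hxz hyz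
    rw [← NNReal.coe_le_coe, hη]
    push_cast
    rw [div_le_iff₀ (hpos hyz)]
    have hx := norm_pos_iff.2 (sub_ne_zero.2 hxz)
    have hy := norm_pos_iff.2 (sub_ne_zero.2 hyz)
    have h1 := hΦ z _ _ hx hy
    have h2 : 0 ≤ M * ((‖x - z‖ / ‖y - z‖) ^ α + (‖x - z‖ / ‖y - z‖) ^ β) :=
      nonneg_of_mul_nonneg_left ((h.pos z _ hx).le.trans h1) (h.pos z _ hy)
    have h3 := mul_le_mul_of_nonneg_left (h.le_norm_sub hC hyz) h2
    linarith [h.norm_sub_le x z hxz]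

end Scale

/-! ### Increments of `f_μ` -/

section Increments

variable {E : Type*} [NormedAddCommGroup E] [InnerProductSpace ℝ E] [FiniteDimensional ℝ E]
  [MeasurableSpace E] [BorelSpace E] {μ : Measure E} [IsLocallyFiniteMeasure μ] {C : ℝ}

omit [FiniteDimensional ℝ E] in
@[fun_prop]
lemma measurable_unitDir : Measurable (unitDir : E → E) := by
  unfold unitDir
  fun_prop

lemma HasDecay.integrable_unitDir_sub (h : HasDecay μ) (x y : E) :
    Integrable (fun w => unitDir (x - w) - unitDir (y - w)) μ := by
  rcases eq_or_ne x y with rfl | hxy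
  · simp
  have hr : 0 < ‖x - y‖ := norm_pos_iff.2 (sub_ne_zero.2 hxy)
  refine ((h.integrable_div_add_norm y hr).const_mul 4).mono'
    (Measurable.aestronglyMeasurable (by fun_prop)) (Filter.Eventually.of_forall fun w => ?_)
  have := norm_unitDir_sub_le_div (a := x - w) (b := y - w) (by simpa using hr)
  simpa using this

lemma HasDecay.integrable_inner_unitDir_sub (h : HasDecay μ) (x y : E) :
    Integrable (fun w => inner ℝ (unitDir (x - w) - unitDir (y - w)) (x - y)) μ :=
  (h.integrable_unitDir_sub x y).inner_const (x - y)

omit [FiniteDimensional ℝ E] [MeasurableSpace E] [BorelSpace E] in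
lemma inner_unitDir_sub_sub_nonneg (x y w : E) :
    0 ≤ inner ℝ (unitDir (x - w) - unitDir (y - w)) (x - y) := by
  simpa using inner_unitDir_sub_nonneg (x - w) (y - w)

lemma HasDecay.norm_integral_unitDir_sub_le (h : HasDecay μ) {x y : E} (hxy : x ≠ y) :
    ‖∫ w, (unitDir (x - w) - unitDir (y - w)) ∂μ‖
      ≤ 4 * ∫ w, ‖x - y‖ / (‖x - y‖ + ‖y - w‖) ∂μ := by
  have hr : 0 < ‖x - y‖ := norm_pos_iff.2 (sub_ne_zero.2 hxy)
  rw [← integral_const_mul]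
  refine norm_integral_le_of_norm_le ((h.integrable_div_add_norm y hr).const_mul 4)
    (Filter.Eventually.of_forall fun w => ?_)
  have := norm_unitDir_sub_le_div (a := x - w) (b := y - w) (by simpa using hr)
  simpa using this

/-- On a line the increment of `f_μ` only sees the mass between the two points. -/
lemma norm_integral_unitDir_sub_le_of_finrank_eq_one (hE : Module.finrank ℝ E = 1) (x y : E) :
    ‖∫ w, (unitDir (x - w) - unitDir (y - w)) ∂μ‖ ≤ 2 * μ.real (closedBall y ‖x - y‖) := by
  have hsupp : ∀ w ∉ closedBall y ‖x - y‖, unitDir (x - w) - unitDir (y - w) = 0 := by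
    intro w hw
    rw [mem_closedBall, not_le, dist_comm, dist_eq_norm] at hw
    rw [unitDir_eq_of_finrank_eq_one hE (a := x - w) (b := y - w) (by simpa using hw), sub_self]
  rw [← setIntegral_eq_integral_of_forall_compl_eq_zero hsupp]
  exact norm_setIntegral_le_of_norm_le_const measure_closedBall_lt_top
    fun w _ => norm_unitDir_sub_le_two _ _

/-- The mass near the midpoint of `x` and `y` bounds the monotonicity of `f_μ` from below. -/
lemma HasDoublingConstant.mul_measureReal_le_integral_inner (hd : HasDoublingConstant μ C)
    (hC : 1 ≤ C) (h : HasDecay μ) {x y : E} (hxy : x ≠ y) :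
    ‖x - y‖ * μ.real (closedBall y ‖x - y‖)
      ≤ 2 * C ^ 3 * ∫ w, inner ℝ (unitDir (x - w) - unitDir (y - w)) (x - y) ∂μ := by
  have hr : 0 < ‖x - y‖ := norm_pos_iff.2 (sub_ne_zero.2 hxy)
  set m : E := (2 : ℝ)⁻¹ • (x + y) with hm
  set S := closedBall m (‖x - y‖ / 4)
  have hball : μ.real (closedBall y ‖x - y‖) ≤ C ^ 3 * μ.real S := by
    refine hd.measureReal_closedBall_le hC (by positivity) 3 ?_
    rw [dist_comm, dist_eq_norm, show m - y = (2 : ℝ)⁻¹ • (x - y) by rw [hm]; module, norm_smul]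
    norm_num
    linarith
  have hint := h.integrable_inner_unitDir_sub x y
  have hlow : μ.real S * (2 / 3 * ‖x - y‖)
      ≤ ∫ w in S, inner ℝ (unitDir (x - w) - unitDir (y - w)) (x - y) ∂μ := by
    rw [← smul_eq_mul, ← setIntegral_const]
    refine setIntegral_mono_on (integrableOn_const measure_closedBall_lt_top.ne)
      hint.integrableOn isClosed_closedBall.measurableSet fun w hw => ?_
    rw [mem_closedBall, dist_comm, dist_eq_norm] at hw
    have := norm_sub_le_inner_unitDir (a := x - w) (b := y - w) (by
      rw [show x - w + (y - w) = (2 : ℝ) • (m - w) by rw [hm]; module, norm_smul,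
        sub_sub_sub_cancel_right]
      norm_num
      linarith)
    rw [sub_sub_sub_cancel_right] at this
    linarith
  have hle := setIntegral_le_integral (s := S) hint
    (Filter.Eventually.of_forall fun w => inner_unitDir_sub_sub_nonneg x y w)
  have h1 := mul_le_mul_of_nonneg_left hball hr.le
  have h2 := mul_le_mul_of_nonneg_left (hlow.trans hle) (by positivity : 0 ≤ 2 * C ^ 3)
  have h3 : 0 ≤ C ^ 3 * μ.real S * ‖x - y‖ := by positivity
  linarith

omit [FiniteDimensional ℝ E] [MeasurableSpace E] [BorelSpace E] in
/-- At dyadic distance `2 ^ k |x - y|` from `y`, points near the hyperplane through `y` orthogonal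
to `x - y` see the segment from `x` to `y` at a large angle. -/
lemma norm_sub_div_le_inner_unitDir {x y e w : E} (hxy : x ≠ y) (he : ‖e‖ = 1)
    (hort : inner ℝ e (x - y) = 0) (k : ℕ)
    (hw : w ∈ closedBall (y + (3 / 2 * 2 ^ k * ‖x - y‖) • e) (2 ^ k * ‖x - y‖ / 4)) :
    ‖x - y‖ / (8 * (1 + 2 ^ k)) ≤ inner ℝ (unitDir (x - w) - unitDir (y - w)) (x - y) := by
  have hr : 0 < ‖x - y‖ := norm_pos_iff.2 (sub_ne_zero.2 hxy)
  have h2k : (1 : ℝ) ≤ 2 ^ k := one_le_pow₀ one_le_two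
  set r := ‖x - y‖ with hr_def
  set ρ := 2 ^ k * r with hρ
  have hρ0 : 0 < ρ := by positivity
  rw [show 3 / 2 * 2 ^ k * r = 3 / 2 * ρ by ring, mem_closedBall, dist_eq_norm] at hw
  set q := w - (y + (3 / 2 * ρ) • e) with hq
  have hb : y - w = -((3 / 2 * ρ) • e + q) := by rw [hq]; module
  have hne : ‖(3 / 2 * ρ) • e‖ = 3 / 2 * ρ := by
    rw [norm_smul, he, mul_one, Real.norm_of_nonneg (by positivity)]
  have hb1 : 5 / 4 * ρ ≤ ‖y - w‖ := by
    rw [hb, norm_neg]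
    have := norm_sub_le ((3 / 2 * ρ) • e + q) q
    rw [add_sub_cancel_right, hne] at this
    linarith
  have hb2 : ‖y - w‖ ≤ 7 / 4 * ρ := by
    rw [hb, norm_neg]
    linarith [norm_add_le ((3 / 2 * ρ) • e) q]
  have hin : inner ℝ (y - w) (x - y) ^ 2 ≤ (ρ / 4 * r) ^ 2 := by
    rw [hb, inner_neg_left, inner_add_left, real_inner_smul_left, hort, mul_zero, zero_add, neg_sq,
      ← sq_abs]
    gcongr
    exact (abs_real_inner_le_norm _ _).trans (by gcongr)
  have hb3 : (5 / 4 * ρ) ^ 2 ≤ ‖y - w‖ ^ 2 := by gcongr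
  have key := sq_norm_sub_le_inner_unitDir (a := x - w) (b := y - w)
    (norm_pos_iff.1 (by linarith)) (by
      rw [sub_sub_sub_cancel_right, ← hr_def]
      nlinarith [mul_le_mul_of_nonneg_right hb3 (sq_nonneg r), sq_nonneg (ρ * r)])
  rw [sub_sub_sub_cancel_right, ← hr_def] at key
  have hI := inner_unitDir_sub_sub_nonneg x y w
  generalize inner ℝ (unitDir (x - w) - unitDir (y - w)) (x - y) = I at *
  rw [div_le_iff₀ (by positivity)]
  have h1 : 4 * (r + ‖y - w‖) * I ≤ 4 * (2 * (1 + 2 ^ k) * r) * I := by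
    gcongr
    rw [hρ] at hb2
    nlinarith
  refine le_of_mul_le_mul_left ?_ hr
  linarith

/-- In dimension at least two `f_μ` is quantitatively monotone. Each dyadic annulus about `y` has
mass comparable to that of a ball inside it, centred on the hyperplane through `y` orthogonal to
`x - y`, where the integrand is large. -/
lemma HasDoublingConstant.mul_integral_le_integral_inner (hd : HasDoublingConstant μ C)
    (hC : 1 ≤ C) (h : HasDecay μ) (hE : 2 ≤ Module.finrank ℝ E) {x y : E} (hxy : x ≠ y) :
    ‖x - y‖ * ∫ w, ‖x - y‖ / (‖x - y‖ + ‖y - w‖) ∂μ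
      ≤ 16 * C ^ 4 * ∫ w, inner ℝ (unitDir (x - w) - unitDir (y - w)) (x - y) ∂μ := by
  obtain ⟨e, he, hort⟩ : ∃ e : E, ‖e‖ = 1 ∧ inner ℝ e (x - y) = 0 := by
    have hlt : Module.finrank ℝ (ℝ ∙ (x - y)) < Module.finrank ℝ E :=
      (finrank_span_singleton (sub_ne_zero.2 hxy)).trans_lt (by omega)
    have hpos : 0 < Module.finrank ℝ (ℝ ∙ (x - y))ᗮ := by
      have := (ℝ ∙ (x - y)).finrank_add_finrank_orthogonal
      omega
    have := Module.nontrivial_of_finrank_pos hpos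
    obtain ⟨e, he⟩ := exists_norm_eq (ℝ ∙ (x - y))ᗮ (c := 1) zero_le_one
    refine ⟨e, he, ?_⟩
    rw [real_inner_comm]
    exact Submodule.mem_orthogonal_singleton_iff_inner_right.1 e.2
  have hr : 0 < ‖x - y‖ := norm_pos_iff.2 (sub_ne_zero.2 hxy)
  have hI := h.integrable_inner_unitDir_sub x y
  have hJ := h.integrable_div_add_norm y hr
  set r := ‖x - y‖ with hr_def
  set f : ℕ → Set E := fun k => closedBall y (2 ^ (k + 1) * r) with hf
  have hfm (k : ℕ) : MeasurableSet (f k) := isClosed_closedBall.measurableSet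
  have hf_mono : Monotone f := fun i j hij => closedBall_subset_closedBall (by gcongr; norm_num)
  -- the dyadic annuli about `y`, the first one being a full ball
  set A := disjointed f with hA
  have hAm (k : ℕ) : MeasurableSet (A k) := MeasurableSet.disjointed hfm k
  have hAd : Pairwise (Function.onFun Disjoint A) := disjoint_disjointed f
  have hAU : ⋃ k, A k = univ := by
    rw [hA, iUnion_disjointed, eq_univ_iff_forall]
    intro w
    obtain ⟨k, hk⟩ := pow_unbounded_of_one_lt (dist w y / r) one_lt_two
    refine mem_iUnion.2 ⟨k, mem_closedBall.2 ?_⟩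
    rw [div_lt_iff₀ hr] at hk
    refine hk.le.trans ?_
    gcongr
    · norm_num
    · omega
  have hA_succ (k : ℕ) : A (k + 1) = f (k + 1) \ f k :=
    hf_mono.disjointed_succ (not_isMax k)
  have hfar (k : ℕ) (w : E) (hw : w ∈ A k) : r * (1 + 2 ^ k) ≤ 2 * (r + ‖y - w‖) := by
    rcases k with _ | k
    · linarith [norm_nonneg (y - w)]
    · rw [hA_succ] at hw
      have := hw.2
      rw [mem_closedBall, not_le, dist_comm, dist_eq_norm] at this
      have : 0 < 2 ^ (k + 1) * r := by positivity
      linarith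
  -- comparison balls inside the annuli, around points with `x - y` orthogonal to the radius
  set B : ℕ → Set E := fun k => closedBall (y + (3 / 2 * 2 ^ k * r) • e) (2 ^ k * r / 4) with hB
  have hdist (k : ℕ) : dist y (y + (3 / 2 * 2 ^ k * r) • e) = 3 / 2 * 2 ^ k * r := by
    rw [dist_self_add_right, norm_smul, he, mul_one, Real.norm_of_nonneg (by positivity)]
  have hBA (k : ℕ) : B k ⊆ A k := by
    intro w hw
    rw [hB, mem_closedBall] at hw
    have h1 : dist w y ≤ 2 ^ (k + 1) * r := by
      have := dist_triangle w (y + (3 / 2 * 2 ^ k * r) • e) y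
      rw [dist_comm (y + _) y, hdist] at this
      have : 0 < 2 ^ k * r := by positivity
      rw [pow_succ]
      linarith
    rcases k with _ | k
    · rw [hA, disjointed_zero]
      exact mem_closedBall.2 h1
    · rw [hA_succ]
      refine ⟨mem_closedBall.2 h1, ?_⟩
      rw [mem_closedBall, not_le]
      have := dist_triangle y w (y + (3 / 2 * 2 ^ (k + 1) * r) • e)
      rw [hdist, dist_comm y w] at this
      have : 0 < 2 ^ (k + 1) * r := by positivity
      linarith
  have hmass (k : ℕ) : μ.real (A k) ≤ C ^ 4 * μ.real (B k) := by
    refine (measureReal_mono (disjointed_subset f k) measure_closedBall_lt_top.ne).trans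
      (hd.measureReal_closedBall_le hC (by positivity) 4 ?_)
    have : 0 < 2 ^ k * r := by positivity
    rw [hdist, pow_succ]
    linarith
  have hAtop (k : ℕ) : μ (A k) ≠ ∞ :=
    ((measure_mono (disjointed_subset f k)).trans_lt measure_closedBall_lt_top).ne
  have hpiece (k : ℕ) : ∫ w in A k, r * (r / (r + ‖y - w‖)) ∂μ ≤ ∫ w in A k,
      16 * C ^ 4 * inner ℝ (unitDir (x - w) - unitDir (y - w)) (x - y) ∂μ := by
    calc ∫ w in A k, r * (r / (r + ‖y - w‖)) ∂μ
        ≤ ∫ _ in A k, 2 * r / (1 + 2 ^ k) ∂μ := by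
          refine setIntegral_mono_on (hJ.const_mul r).integrableOn
            (integrableOn_const (hAtop k)) (hAm k) fun w hw => ?_
          rw [← mul_div_assoc, div_le_div_iff₀ (by positivity) (by positivity)]
          have := mul_le_mul_of_nonneg_left (hfar k w hw) hr.le
          linarith
      _ = μ.real (A k) * (2 * r / (1 + 2 ^ k)) := by rw [setIntegral_const, smul_eq_mul]
      _ ≤ C ^ 4 * μ.real (B k) * (2 * r / (1 + 2 ^ k)) := by gcongr; exact hmass k
      _ = 16 * C ^ 4 * ∫ _ in B k, r / (8 * (1 + 2 ^ k)) ∂μ := by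
          rw [setIntegral_const, smul_eq_mul]
          field_simp
          ring
      _ ≤ 16 * C ^ 4 * ∫ w in B k,
            inner ℝ (unitDir (x - w) - unitDir (y - w)) (x - y) ∂μ := by
          refine mul_le_mul_of_nonneg_left ?_ (by positivity)
          exact setIntegral_mono_on (integrableOn_const measure_closedBall_lt_top.ne)
            hI.integrableOn isClosed_closedBall.measurableSet
            fun w hw => norm_sub_div_le_inner_unitDir hxy he hort k hw
      _ ≤ 16 * C ^ 4 * ∫ w in A k,
            inner ℝ (unitDir (x - w) - unitDir (y - w)) (x - y) ∂μ := by
          refine mul_le_mul_of_nonneg_left ?_ (by positivity)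
          exact setIntegral_mono_set hI.integrableOn
            (Filter.Eventually.of_forall fun w => inner_unitDir_sub_sub_nonneg x y w)
            (hBA k).eventuallyLE
      _ = _ := (integral_const_mul _ _).symm
  rw [← integral_const_mul, ← integral_const_mul, ← setIntegral_univ, ← setIntegral_univ (μ := μ)
    (f := fun w => 16 * C ^ 4 * inner ℝ (unitDir (x - w) - unitDir (y - w)) (x - y)), ← hAU]
  exact hasSum_le hpiece
    (hasSum_integral_iUnion hAm hAd (hJ.const_mul r).integrableOn)
    (hasSum_integral_iUnion hAm hAd (hI.const_mul _).integrableOn)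

end Increments

/-! ### Scale functions of `f_μ` -/

section ScaleOfMap

variable {n : ℕ} {μ : Measure (EuclideanSpace ℝ (Fin n))} [IsLocallyFiniteMeasure μ] {C : ℝ}

lemma kernelMap_eq (x z : EuclideanSpace ℝ (Fin n)) :
    kernelMap x z = unitDir (x - z) - unitDir (0 - z) := by
  simp [kernelMap, unitDir]

lemma HasDecay.integrable_kernelMap (h : HasDecay μ) (x : EuclideanSpace ℝ (Fin n)) :
    Integrable (kernelMap x) μ :=
  (h.integrable_unitDir_sub x 0).congr
    (Filter.Eventually.of_forall fun z => (kernelMap_eq x z).symm)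

lemma HasDecay.fMap_sub (h : HasDecay μ) (x y : EuclideanSpace ℝ (Fin n)) :
    fMap μ x - fMap μ y = (1 / 2 : ℝ) • ∫ w, (unitDir (x - w) - unitDir (y - w)) ∂μ := by
  rw [fMap, fMap, ← smul_sub, ← integral_sub (h.integrable_kernelMap x) (h.integrable_kernelMap y)]
  simp only [kernelMap_eq, sub_sub_sub_cancel_right]

lemma HasDecay.inner_fMap_sub (h : HasDecay μ) (x y : EuclideanSpace ℝ (Fin n)) :
    inner ℝ (fMap μ x - fMap μ y) (x - y)
      = 1 / 2 * ∫ w, inner ℝ (unitDir (x - w) - unitDir (y - w)) (x - y) ∂μ := by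
  rw [h.fMap_sub, real_inner_smul_left, real_inner_comm,
    ← integral_inner (h.integrable_unitDir_sub x y)]
  simp only [real_inner_comm]

/-- On the line the mass of balls is a scale function of `f_μ`. -/
lemma isScaleFunction_measureReal (hn : n = 1) (hC : 1 ≤ C) (hμ : μ ≠ 0)
    (hd : HasDoublingConstant μ C) (h : HasDecay μ) :
    IsScaleFunction C (fMap μ) (fun y r => μ.real (closedBall y r)) := by
  have hE : Module.finrank ℝ (EuclideanSpace ℝ (Fin n)) = 1 := by simp [hn]
  have : Nontrivial (EuclideanSpace ℝ (Fin n)) :=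
    Module.nontrivial_of_finrank_pos (R := ℝ) (by omega)
  have hC34 : C ^ 3 ≤ C ^ 4 := pow_le_pow_right₀ hC (by norm_num)
  constructor
  · exact fun y r hr => hd.measureReal_closedBall_pos hC hμ y hr
  · exact fun y r s _ hrs =>
      measureReal_mono (closedBall_subset_closedBall hrs) measure_closedBall_lt_top.ne
  · intro y r hr
    refine (hd.measureReal_closedBall_two_mul_le hC y hr).trans ?_
    gcongr
    linarith
  · intro y r hr
    have h1 := hd.measureReal_closedBall_le_annulus hC y hr
    rw [measureReal_sdiff (closedBall_subset_closedBall (by linarith))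
      isClosed_closedBall.measurableSet measure_closedBall_lt_top.ne] at h1
    have h2 : 1 / (4 * (1 + 2 * C ^ 4)) * C ^ 4 ≤ 1 := by
      rw [div_mul_eq_mul_div]
      refine div_le_one_of_le₀ ?_ (by positivity)
      nlinarith [pow_pos (zero_lt_one.trans_le hC) 4]
    have h3 : 0 ≤ 1 / (4 * (1 + 2 * C ^ 4)) := by positivity
    have h4 : μ.real (closedBall y (r / 2)) ≤ μ.real (closedBall y r) :=
      measureReal_mono (closedBall_subset_closedBall (by linarith)) measure_closedBall_lt_top.ne
    nlinarith [mul_le_mul_of_nonneg_left h1 h3,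
      mul_le_mul_of_nonneg_right h2 (sub_nonneg.2 h4)]
  · intro x y _
    rw [h.fMap_sub, norm_smul]
    have := norm_integral_unitDir_sub_le_of_finrank_eq_one (μ := μ) hE x y
    have h0 : 0 ≤ μ.real (closedBall y ‖x - y‖) := measureReal_nonneg
    norm_num
    linarith
  · intro x y hxy
    have h1 := hd.mul_measureReal_le_integral_inner hC h hxy
    have h2 : 0 ≤ ∫ w, inner ℝ (unitDir (x - w) - unitDir (y - w)) (x - y) ∂μ :=
      integral_nonneg fun w => inner_unitDir_sub_sub_nonneg x y w
    rw [h.inner_fMap_sub]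
    nlinarith [mul_le_mul_of_nonneg_right hC34 h2, pow_pos (zero_lt_one.trans_le hC) 4]

/-- In dimension at least two `r ∫ (r + |y - w|)⁻¹ dμ(w)` is a scale function of `f_μ`. -/
lemma isScaleFunction_integral (hn : 2 ≤ n) (hC : 1 ≤ C) (hμ : μ ≠ 0)
    (hd : HasDoublingConstant μ C) (h : HasDecay μ) :
    IsScaleFunction C (fMap μ) (fun y r => ∫ w, r / (r + ‖y - w‖) ∂μ) := by
  have hE : 2 ≤ Module.finrank ℝ (EuclideanSpace ℝ (Fin n)) := by simpa using hn
  have : Nontrivial (EuclideanSpace ℝ (Fin n)) :=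
    Module.nontrivial_of_finrank_pos (R := ℝ) (by omega)
  -- the integrand is at least `1 / 2` on the ball of radius `r` about `y`
  have hball (y : EuclideanSpace ℝ (Fin n)) (r : ℝ) (hr : 0 < r) (S : Set _)
      (hS : MeasurableSet S) (hSr : S ⊆ closedBall y r) :
      μ.real S ≤ 2 * ∫ w in S, r / (r + ‖y - w‖) ∂μ := by
    have : μ.real S * (1 / 2) ≤ ∫ w in S, r / (r + ‖y - w‖) ∂μ := by
      rw [← smul_eq_mul, ← setIntegral_const]
      refine setIntegral_mono_on (integrableOn_const
        ((measure_mono hSr).trans_lt measure_closedBall_lt_top).ne)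
        (h.integrable_div_add_norm y hr).integrableOn hS fun w hw => ?_
      have := hSr hw
      rw [mem_closedBall, dist_comm, dist_eq_norm] at this
      rw [div_le_div_iff₀ zero_lt_two (by positivity)]
      linarith
    linarith
  constructor
  · intro y r hr
    have h1 := hd.measureReal_closedBall_pos hC hμ y hr
    have h2 := hball y r hr _ isClosed_closedBall.measurableSet subset_rfl
    have h3 := setIntegral_le_integral (s := closedBall y r) (h.integrable_div_add_norm y hr)
      (Filter.Eventually.of_forall fun w => by simp only [Pi.zero_apply]; positivity)
    linarith
  · intro y r s hr hrs
    have hs := hr.trans_le hrs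
    refine integral_mono (h.integrable_div_add_norm y hr) (h.integrable_div_add_norm y hs)
      fun w => ?_
    change r / (r + ‖y - w‖) ≤ s / (s + ‖y - w‖)
    rw [div_le_div_iff₀ (by positivity) (by positivity)]
    nlinarith [norm_nonneg (y - w)]
  · intro y r hr
    rw [← integral_const_mul]
    refine integral_mono (h.integrable_div_add_norm y (by positivity))
      ((h.integrable_div_add_norm y hr).const_mul _) fun w => ?_
    change 2 * r / (2 * r + ‖y - w‖) ≤ 2 * C * (r / (r + ‖y - w‖))
    rw [← mul_div_assoc]
    gcongr
    · nlinarith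
    · linarith
  -- Halving `r` lowers the integrand by a quarter outside the ball of radius `r / 2`, and the
  -- annulus lemma shows that a fixed part of the integral lives there.
  · intro y r hr
    have hg := h.integrable_div_add_norm y hr
    have hg2 := h.integrable_div_add_norm y (half_pos hr)
    set S := closedBall y (r / 2) with hS
    have hSm : MeasurableSet S := isClosed_closedBall.measurableSet
    have h1 : ∫ w in S, r / 2 / (r / 2 + ‖y - w‖) ∂μ ≤ ∫ w in S, r / (r + ‖y - w‖) ∂μ := by
      refine setIntegral_mono hg2.integrableOn hg.integrableOn fun w => ?_
      change r / 2 / (r / 2 + ‖y - w‖) ≤ r / (r + ‖y - w‖)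
      rw [div_le_div_iff₀ (by positivity) (by positivity)]
      nlinarith [norm_nonneg (y - w)]
    have h2 : ∫ w in Sᶜ, r / 2 / (r / 2 + ‖y - w‖) ∂μ
        ≤ 3 / 4 * ∫ w in Sᶜ, r / (r + ‖y - w‖) ∂μ := by
      rw [← integral_const_mul]
      refine setIntegral_mono_on hg2.integrableOn (hg.const_mul _).integrableOn hSm.compl
        fun w hw => ?_
      rw [mem_compl_iff, hS, mem_closedBall, not_le, dist_comm, dist_eq_norm] at hw
      rw [← mul_div_assoc, div_le_div_iff₀ (by positivity) (by positivity)]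
      nlinarith [norm_nonneg (y - w)]
    have h3 : ∫ w in S, r / (r + ‖y - w‖) ∂μ ≤ μ.real S := by
      rw [← mul_one (μ.real S), ← smul_eq_mul, ← setIntegral_const]
      refine setIntegral_mono hg.integrableOn (integrableOn_const measure_closedBall_lt_top.ne)
        fun w => div_le_one_of_le₀ ?_ (by positivity)
      linarith [norm_nonneg (y - w)]
    have h4 : μ.real S ≤ μ.real (closedBall y r) :=
      measureReal_mono (closedBall_subset_closedBall (by linarith)) measure_closedBall_lt_top.ne
    have h5 := hd.measureReal_closedBall_le_annulus hC y hr
    have h6 := hball y r hr _ (isClosed_closedBall.measurableSet.diff hSm) sdiff_subset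
    have h7 : ∫ w in closedBall y r \ S, r / (r + ‖y - w‖) ∂μ
        ≤ ∫ w in Sᶜ, r / (r + ‖y - w‖) ∂μ :=
      setIntegral_mono_set hg.integrableOn
        (Filter.Eventually.of_forall fun w => by simp only [Pi.zero_apply]; positivity)
        (LE.le.eventuallyLE fun w hw => hw.2)
    rw [← integral_add_compl hSm hg, ← integral_add_compl hSm hg2]
    generalize ∫ w in S, r / 2 / (r / 2 + ‖y - w‖) ∂μ = P' at *
    generalize ∫ w in Sᶜ, r / 2 / (r / 2 + ‖y - w‖) ∂μ = J' at *
    generalize ∫ w in S, r / (r + ‖y - w‖) ∂μ = P at *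
    generalize ∫ w in Sᶜ, r / (r + ‖y - w‖) ∂μ = J at *
    have h8 : P ≤ C ^ 4 * (2 * J) :=
      (h3.trans (h4.trans h5)).trans (by gcongr; linarith)
    have h9 : 1 / (4 * (1 + 2 * C ^ 4)) * (P + J) ≤ J / 4 := by
      rw [div_mul_eq_mul_div, div_le_div_iff₀ (by positivity) (by norm_num)]
      linarith
    linarith
  · intro x y hxy
    rw [h.fMap_sub, norm_smul]
    have := h.norm_integral_unitDir_sub_le hxy
    norm_num
    linarith
  · intro x y hxy
    have := hd.mul_integral_le_integral_inner hC h hE hxy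
    rw [h.inner_fMap_sub]
    linarith

end ScaleOfMap

/-! ### The derivative of `f_μ` -/

section Derivative

lemma norm_unitDirDeriv_le {E : Type*} [NormedAddCommGroup E] [InnerProductSpace ℝ E] {v : E}
    (hv : v ≠ 0) : ‖unitDirDeriv v‖ ≤ 2 * ‖v‖⁻¹ := by
  refine (hasFDerivAt_unitDir hv).le_of_lip' (by positivity)
    (Filter.Eventually.of_forall fun w => ?_)
  have := norm_unitDir_sub_mul_norm_le w v
  rw [mul_right_comm, ← div_eq_mul_inv, le_div_iff₀ (norm_pos_iff.2 hv)]
  exact this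

lemma sum_inner_unitDirDeriv {E ι : Type*} [NormedAddCommGroup E] [InnerProductSpace ℝ E]
    [Fintype ι] (b : OrthonormalBasis ι ℝ E) (v : E) :
    ∑ i, inner ℝ (unitDirDeriv v (b i)) (b i) = (Fintype.card ι - 1) * ‖v‖⁻¹ := by
  have h1 (i : ι) : inner ℝ (unitDirDeriv v (b i)) (b i)
      = ‖v‖⁻¹ - ‖v‖⁻¹ ^ 3 * inner ℝ v (b i) ^ 2 := by
    simp only [unitDirDeriv, sub_apply, smul_apply,
      ContinuousLinearMap.id_apply, ContinuousLinearMap.smulRight_apply, innerSL_apply_apply,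
      inner_sub_left, real_inner_smul_left, real_inner_self_eq_norm_sq, b.norm_eq_one]
    ring
  have h2 : ∑ i, inner ℝ v (b i) ^ 2 = ‖v‖ ^ 2 := by
    simpa using b.sum_sq_norm_inner_left v
  simp only [h1, Finset.sum_sub_distrib, ← Finset.mul_sum, h2, Finset.sum_const,
    Finset.card_univ, nsmul_eq_mul]
  rcases eq_or_ne v 0 with rfl | hv
  · simp
  · have := norm_ne_zero_iff.2 hv
    field_simp

@[fun_prop]
lemma measurable_unitDirDeriv {E : Type*} [NormedAddCommGroup E] [InnerProductSpace ℝ E]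
    [FiniteDimensional ℝ E] [MeasurableSpace E] [BorelSpace E] :
    Measurable (unitDirDeriv : E → E →L[ℝ] E) := by
  have h : Continuous fun v : E => (innerSL ℝ v).smulRight v := by fun_prop
  unfold unitDirDeriv
  exact (measurable_norm.inv.smul_const _).sub ((measurable_norm.inv.pow_const 3).smul h.measurable)

variable {n : ℕ} {μ : Measure (EuclideanSpace ℝ (Fin n))}

lemma rieszPotential_eq_lintegral (x : EuclideanSpace ℝ (Fin n)) :
    rieszPotential ((n : ℝ) - 1) μ x = ∫⁻ z, ‖x - z‖ₑ⁻¹ ∂μ := by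
  simp [rieszPotential, ENNReal.rpow_neg_one]

/-- Where the potential is finite there is no atom, as the kernel is infinite on the diagonal. -/
lemma ae_ne_of_lintegral_ne_top {x : EuclideanSpace ℝ (Fin n)}
    (hx : ∫⁻ z, ‖x - z‖ₑ⁻¹ ∂μ ≠ ∞) : ∀ᵐ z ∂μ, x - z ≠ 0 := by
  filter_upwards [ae_lt_top (by fun_prop) hx] with z hz h0
  simp [h0] at hz

lemma ofReal_norm_inv_eq {E : Type*} [NormedAddCommGroup E] {v : E} (hv : v ≠ 0) :
    ENNReal.ofReal ‖v‖⁻¹ = ‖v‖ₑ⁻¹ := by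
  rw [ENNReal.ofReal_inv_of_pos (norm_pos_iff.2 hv), ofReal_norm]

lemma integrable_norm_sub_inv {x : EuclideanSpace ℝ (Fin n)}
    (hx : ∫⁻ z, ‖x - z‖ₑ⁻¹ ∂μ ≠ ∞) : Integrable (fun z => ‖x - z‖⁻¹) μ := by
  refine (lintegral_ofReal_ne_top_iff_integrable (Measurable.aestronglyMeasurable (by fun_prop))
    (Filter.Eventually.of_forall fun z => by simp)).1 ?_
  rwa [lintegral_congr_ae ((ae_ne_of_lintegral_ne_top hx).mono fun z hz => ofReal_norm_inv_eq hz)]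

lemma lintegral_enorm_sub_inv_eq {x : EuclideanSpace ℝ (Fin n)}
    (hx : ∫⁻ z, ‖x - z‖ₑ⁻¹ ∂μ ≠ ∞) :
    ∫⁻ z, ‖x - z‖ₑ⁻¹ ∂μ = ENNReal.ofReal (∫ z, ‖x - z‖⁻¹ ∂μ) := by
  rw [ofReal_integral_eq_lintegral_ofReal (integrable_norm_sub_inv hx)
    (Filter.Eventually.of_forall fun z => by simp)]
  exact (lintegral_congr_ae
    ((ae_ne_of_lintegral_ne_top hx).mono fun z hz => ofReal_norm_inv_eq hz)).symm

variable [IsLocallyFiniteMeasure μ]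

/-- `f_μ` is differentiable wherever the potential is finite, by differentiation under the
integral sign: the difference quotients of the kernel at `x` are dominated by `2 |x - z|⁻¹`. -/
lemma HasDecay.hasFDerivAt_fMap (h : HasDecay μ) {x : EuclideanSpace ℝ (Fin n)}
    (hx : ∫⁻ z, ‖x - z‖ₑ⁻¹ ∂μ ≠ ∞) :
    Integrable (fun z => unitDirDeriv (x - z)) μ ∧
      HasFDerivAt (fMap μ) ((1 / 2 : ℝ) • ∫ z, unitDirDeriv (x - z) ∂μ) x := by
  have hne := ae_ne_of_lintegral_ne_top hx
  have key := hasFDerivAt_integral_of_dominated_loc_of_lip' (𝕜 := ℝ) (μ := μ) (s := univ)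
    (F := kernelMap) (F' := fun z => unitDirDeriv (x - z)) (x₀ := x)
    (bound := fun z => 2 * ‖x - z‖⁻¹) Filter.univ_mem
    (fun y _ => (h.integrable_kernelMap y).aestronglyMeasurable) (h.integrable_kernelMap x)
    (Measurable.aestronglyMeasurable (by fun_prop)) ?_
    ((integrable_norm_sub_inv hx).const_mul 2) ?_
  · exact ⟨key.1, key.2.const_smul (1 / 2 : ℝ)⟩
  · refine hne.mono fun z hz y _ => ?_
    have := norm_unitDir_sub_mul_norm_le (y - z) (x - z)
    rw [sub_sub_sub_cancel_right] at this
    rw [kernelMap_eq, kernelMap_eq, sub_sub_sub_cancel_right, mul_right_comm, ← div_eq_mul_inv,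
      le_div_iff₀ (norm_pos_iff.2 hz)]
    exact this
  · refine hne.mono fun z hz => ?_
    simp only [kernelMap_eq]
    exact ((hasFDerivAt_unitDir hz).comp x ((hasFDerivAt_id x).sub_const z)).sub_const _

/-- The trace of `Df_μ(x)` is `(n - 1) / 2` times the potential, and is at most `n ‖Df_μ(x)‖`. -/
lemma HasDecay.fderiv_fMap_bounds (h : HasDecay μ) (hn : 2 ≤ n) {x : EuclideanSpace ℝ (Fin n)}
    (hx : ∫⁻ z, ‖x - z‖ₑ⁻¹ ∂μ ≠ ∞) :
    1 / 4 * ∫ z, ‖x - z‖⁻¹ ∂μ ≤ ‖fderiv ℝ (fMap μ) x‖ ∧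
      ‖fderiv ℝ (fMap μ) x‖ ≤ ∫ z, ‖x - z‖⁻¹ ∂μ := by
  obtain ⟨hint, hder⟩ := h.hasFDerivAt_fMap hx
  rw [hder.fderiv]
  have hn2 : (2 : ℝ) ≤ n := by exact_mod_cast hn
  constructor
  · set b := EuclideanSpace.basisFun (Fin n) ℝ
    set D := (1 / 2 : ℝ) • ∫ z, unitDirDeriv (x - z) ∂μ with hD
    have hinti (i : Fin n) : Integrable (fun z => inner ℝ (unitDirDeriv (x - z) (b i)) (b i)) μ :=
      (hint.apply_continuousLinearMap (b i)).inner_const (b i)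
    have htrace : ∑ i, inner ℝ (D (b i)) (b i) = 1 / 2 * ((n - 1) * ∫ z, ‖x - z‖⁻¹ ∂μ) := by
      rw [← integral_const_mul]
      have hsum (z : EuclideanSpace ℝ (Fin n)) : (n - 1 : ℝ) * ‖x - z‖⁻¹
          = ∑ i, inner ℝ (unitDirDeriv (x - z) (b i)) (b i) := by
        rw [sum_inner_unitDirDeriv, Fintype.card_fin]
      simp only [hsum]
      rw [integral_finsetSum _ fun i _ => hinti i, Finset.mul_sum]
      refine Finset.sum_congr rfl fun i _ => ?_
      rw [hD, smul_apply, real_inner_smul_left,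
        ContinuousLinearMap.integral_apply hint, real_inner_comm,
        ← integral_inner (hint.apply_continuousLinearMap (b i))]
      simp only [real_inner_comm]
    have hle : ∑ i, inner ℝ (D (b i)) (b i) ≤ n * ‖D‖ := by
      calc ∑ i, inner ℝ (D (b i)) (b i) ≤ ∑ _i : Fin n, ‖D‖ := by
            refine Finset.sum_le_sum fun i _ => (real_inner_le_norm _ _).trans ?_
            rw [b.norm_eq_one, mul_one]
            exact D.unit_le_opNorm _ (b.norm_eq_one i).le
        _ = n * ‖D‖ := by simp
    have hJ : 0 ≤ ∫ z, ‖x - z‖⁻¹ ∂μ := integral_nonneg fun z => by positivity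
    refine le_of_mul_le_mul_left ?_ (by linarith : (0 : ℝ) < n)
    nlinarith
  · rw [norm_smul]
    have := norm_integral_le_of_norm_le ((integrable_norm_sub_inv hx).const_mul 2)
      ((ae_ne_of_lintegral_ne_top hx).mono fun z hz => norm_unitDirDeriv_le hz)
    rw [integral_const_mul] at this
    norm_num
    linarith

/-! ### Almost everywhere finiteness of the potential -/

lemma lintegral_ball_enorm_inv_lt_top (hn : 2 ≤ n) (R : ℝ) :
    ∫⁻ v in ball (0 : EuclideanSpace ℝ (Fin n)) R, ‖v‖ₑ⁻¹ < ∞ := by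
  have hfin : Module.finrank ℝ (EuclideanSpace ℝ (Fin n)) = n := by simp
  have : Nontrivial (EuclideanSpace ℝ (Fin n)) :=
    Module.nontrivial_of_finrank_pos (R := ℝ) (by omega)
  have h : IntegrableOn (fun v : EuclideanSpace ℝ (Fin n) => ‖v‖⁻¹) (ball 0 R) := by
    rw [integrableOn_fun_norm_addHaar volume (f := fun t : ℝ => t⁻¹), hfin]
    have h1 : IntegrableOn (fun t : ℝ => t ^ (n - 2)) (Ioo 0 R) :=
      ((continuous_pow (n - 2)).integrableOn_Icc (a := 0) (b := R)).mono_set Ioo_subset_Icc_self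
    refine h1.congr_fun (fun t ht => ?_) measurableSet_Ioo
    have ht0 : t ≠ 0 := ht.1.ne'
    change t ^ (n - 2) = t ^ (n - 1) * t⁻¹
    rw [show n - 1 = n - 2 + 1 by omega, pow_succ, mul_assoc, mul_inv_cancel₀ ht0, mul_one]
  refine lt_of_eq_of_lt (lintegral_congr_ae ?_) h.hasFiniteIntegral
  refine ae_restrict_of_ae ((Measure.ae_ne volume 0).mono fun v hv => ?_)
  change ‖v‖ₑ⁻¹ = ‖‖v‖⁻¹‖ₑ
  rw [enorm_inv (norm_ne_zero_iff.2 hv), enorm_norm]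

/-- In dimension at least two the potential is integrable over balls, hence finite almost
everywhere: `|x|⁻¹` is locally integrable, and the decay condition controls the distant mass. -/
lemma HasDecay.ae_lintegral_enorm_sub_inv_ne_top (h : HasDecay μ) (hn : 2 ≤ n) :
    ∀ᵐ x ∂(volume : Measure (EuclideanSpace ℝ (Fin n))), ∫⁻ z, ‖x - z‖ₑ⁻¹ ∂μ ≠ ∞ := by
  have hmeas : Measurable fun p : EuclideanSpace ℝ (Fin n) × EuclideanSpace ℝ (Fin n) =>
      ‖p.1 - p.2‖ₑ⁻¹ := by fun_prop
  have hball (R : ℝ) (hR : 1 ≤ R) :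
      ∫⁻ x in ball (0 : EuclideanSpace ℝ (Fin n)) R, ∫⁻ z, ‖x - z‖ₑ⁻¹ ∂μ ≠ ∞ := by
    rw [lintegral_lintegral_swap hmeas.aemeasurable]
    set A := ∫⁻ v in ball (0 : EuclideanSpace ℝ (Fin n)) (3 * R), ‖v‖ₑ⁻¹ with hA
    have hA_top : A < ∞ := lintegral_ball_enorm_inv_lt_top hn _
    have hnear (z : EuclideanSpace ℝ (Fin n)) (hz : ‖z‖ ≤ 2 * R) :
        ∫⁻ x in ball (0 : EuclideanSpace ℝ (Fin n)) R, ‖x - z‖ₑ⁻¹ ≤ A := by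
      rw [hA, ← lintegral_indicator measurableSet_ball, ← lintegral_indicator measurableSet_ball,
        ← lintegral_sub_right_eq_self ((ball 0 (3 * R)).indicator fun v => ‖v‖ₑ⁻¹) z]
      refine lintegral_mono fun x => ?_
      by_cases hx : x ∈ ball (0 : EuclideanSpace ℝ (Fin n)) R
      · have hxz : x - z ∈ ball (0 : EuclideanSpace ℝ (Fin n)) (3 * R) := by
          rw [mem_ball_zero_iff] at hx ⊢
          linarith [norm_sub_le x z]
        rw [indicator_of_mem hx, indicator_of_mem hxz]
      · rw [indicator_of_notMem hx]
        exact zero_le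
    have hfar (z : EuclideanSpace ℝ (Fin n)) (hz : 2 * R < ‖z‖) :
        ∫⁻ x in ball (0 : EuclideanSpace ℝ (Fin n)) R, ‖x - z‖ₑ⁻¹
          ≤ 2 * volume (ball (0 : EuclideanSpace ℝ (Fin n)) R) * ‖z‖ₑ⁻¹ := by
      calc ∫⁻ x in ball (0 : EuclideanSpace ℝ (Fin n)) R, ‖x - z‖ₑ⁻¹
          ≤ ∫⁻ _ in ball (0 : EuclideanSpace ℝ (Fin n)) R, 2 * ‖z‖ₑ⁻¹ := by
            refine setLIntegral_mono measurable_const fun x hx => ?_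
            rw [mem_ball_zero_iff] at hx
            have h1 : ‖z‖ ≤ 2 * ‖x - z‖ := by
              have := norm_sub_le x (x - z)
              rw [sub_sub_cancel] at this
              linarith
            have hz0 : z ≠ 0 := norm_pos_iff.1 (by linarith)
            have hxz0 : x - z ≠ 0 := norm_pos_iff.1 (by linarith)
            have h2 : ENNReal.ofReal (2 * ‖z‖⁻¹) = 2 * ‖z‖ₑ⁻¹ := by
              rw [ENNReal.ofReal_mul zero_le_two, ENNReal.ofReal_ofNat, ofReal_norm_inv_eq hz0]
            rw [← h2, ← ofReal_norm_inv_eq hxz0]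
            refine ENNReal.ofReal_le_ofReal ?_
            rw [← div_eq_mul_inv, inv_le_comm₀ (norm_pos_iff.2 hxz0)
              (div_pos two_pos (norm_pos_iff.2 hz0)), inv_div]
            linarith
        _ = _ := by rw [setLIntegral_const]; ring
    have hS : MeasurableSet (closedBall (0 : EuclideanSpace ℝ (Fin n)) (2 * R)) :=
      isClosed_closedBall.measurableSet
    rw [← lintegral_add_compl _ hS]
    refine ENNReal.add_ne_top.2 ⟨ne_top_of_le_ne_top ?_
      (setLIntegral_mono measurable_const fun z hz => hnear z (mem_closedBall_zero_iff.1 hz)),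
      ne_top_of_le_ne_top ?_ (setLIntegral_mono (by fun_prop) fun z hz =>
        hfar z (by simpa using hz))⟩
    · rw [setLIntegral_const]
      exact ENNReal.mul_ne_top hA_top.ne measure_closedBall_lt_top.ne
    · rw [lintegral_const_mul _ (by fun_prop)]
      refine ENNReal.mul_ne_top (ENNReal.mul_ne_top (by simp) measure_ball_lt_top.ne) ?_
      refine ne_top_of_le_ne_top h.ne (lintegral_mono_set fun z hz => ?_)
      rw [mem_compl_iff, mem_closedBall_zero_iff, not_le] at hz
      change 1 < ‖z‖
      linarith
  have hae (N : ℕ) : ∀ᵐ x ∂(volume : Measure (EuclideanSpace ℝ (Fin n))),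
      x ∈ ball (0 : EuclideanSpace ℝ (Fin n)) (N + 1) → ∫⁻ z, ‖x - z‖ₑ⁻¹ ∂μ ≠ ∞ := by
    rw [← ae_restrict_iff' measurableSet_ball]
    exact (ae_lt_top hmeas.lintegral_prod_right' (hball (N + 1) (by simp))).mono
      fun x hx => hx.ne
  filter_upwards [ae_all_iff.2 hae] with x hx
  obtain ⟨N, hN⟩ := exists_nat_gt ‖x‖
  exact hx N (mem_ball_zero_iff.2 (by linarith))

end Derivative

theorem theorem1p1 (C : ℝ) (hC : 1 ≤ C) :
    ∃ (η : ℝ≥0 ≃ₜ ℝ≥0) (δ : ℝ), ∀ (n : ℕ), 1 ≤ n →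
      ∀ (μ : Measure (EuclideanSpace ℝ (Fin n))) [IsLocallyFiniteMeasure μ],
        μ ≠ 0 → HasDoublingConstant μ C → HasDecay μ →
        (∀ x, Integrable (kernelMap x) μ) ∧
        IsQuasisymmetric η (fMap μ) ∧
        IsDeltaMonotone δ (fMap μ) ∧
        (2 ≤ n → ∀ᵐ x ∂(volume : Measure (EuclideanSpace ℝ (Fin n))),
          DifferentiableAt ℝ (fMap μ) x ∧
          ENNReal.ofReal (1 / (12 * C ^ 3)) * rieszPotential ((n : ℝ) - 1) μ x
            ≤ ‖fderiv ℝ (fMap μ) x‖ₑ ∧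
          ‖fderiv ℝ (fMap μ) x‖ₑ
            ≤ ENNReal.ofReal Real.pi * rieszPotential ((n : ℝ) - 1) μ x) := by
  have hC3 : 1 ≤ C ^ 3 := one_le_pow₀ hC
  have hC4 : 0 < C ^ 4 := by positivity
  have hq : 1 / (4 * (1 + 2 * C ^ 4)) < 1 := by
    rw [div_lt_one (by positivity)]
    linarith
  have hq' : 0 < 1 / (4 * (1 + 2 * C ^ 4)) := by positivity
  obtain ⟨α, β, M, hα, hβ, hM, hgrowth⟩ := exists_power_growth (K := 2 * C)
    (q := 1 - 1 / (4 * (1 + 2 * C ^ 4))) (by linarith) (by linarith) (by linarith)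
  obtain ⟨η, hη⟩ := exists_homeomorph_power_sum hα hβ (M := 64 * C ^ 4 * M) (by positivity)
  refine ⟨η, 1 / (64 * C ^ 4), fun n hn μ _ hμ hd h => ⟨h.integrable_kernelMap, ?_⟩⟩
  obtain ⟨Φ, hΦ⟩ : ∃ Φ, IsScaleFunction C (fMap μ) Φ := by
    rcases hn.eq_or_lt with h1 | h2
    · exact ⟨_, isScaleFunction_measureReal h1.symm hC hμ hd h⟩
    · exact ⟨_, isScaleFunction_integral h2 hC hμ hd h⟩
  refine ⟨hΦ.isQuasisymmetric hC (fun y => hgrowth (Φ y) (fun r hr => (hΦ.pos y r hr).le)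
    (hΦ.mono y) (hΦ.two_mul_le y) (hΦ.half_le y)) hη, hΦ.isDeltaMonotone hC, fun hn2 => ?_⟩
  filter_upwards [h.ae_lintegral_enorm_sub_inv_ne_top hn2] with x hx
  obtain ⟨hlow, hup⟩ := h.fderiv_fMap_bounds hn2 hx
  have hJ : 0 ≤ ∫ z, ‖x - z‖⁻¹ ∂μ := integral_nonneg fun z => by positivity
  have hC12 : 1 / (12 * C ^ 3) ≤ 1 / 4 :=
    one_div_le_one_div_of_le (by norm_num) (by linarith)
  rw [rieszPotential_eq_lintegral, lintegral_enorm_sub_inv_eq hx, ← ofReal_norm,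
    ← ENNReal.ofReal_mul (by positivity), ← ENNReal.ofReal_mul Real.pi_pos.le]
  refine ⟨(h.hasFDerivAt_fMap hx).2.differentiableAt, ENNReal.ofReal_le_ofReal ?_,
    ENNReal.ofReal_le_ofReal ?_⟩
  · exact (mul_le_mul_of_nonneg_right hC12 hJ).trans hlow
  · exact hup.trans (le_mul_of_one_le_left hJ (by linarith [Real.pi_gt_three]))
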